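/- Conventions. A \emph{dissimilarity} is a continuous function $\Lambda\colon X\times Y\to[0,\infty]$ for topological spaces $X,Y$. A \emph{morphism} $(f_1,f_2)\colon\Lambda\to\Lambda'$ of dissimilarities $\Lambda\colon X\times Y\to[0,\infty]$, $\Lambda'\colon X'\times Y'\to[0,\infty]$ is a pair of continuous maps $f_1\colon X\to X'$, $f_2\colon Y\to Y'$ with $\Lambda'(f_1(x),f_2(y))\le\Lambda(x,y)$ for all $(x,y)$. For $t>0$ the Dowker nerve $N\Lambda_t$ is the simplicial complex of finite $\sigma\subseteq X$ for which some $y\in Y$ satisfies $\Lambda(x,y)<t$ for all $x\in\sigma$; a morphism induces simplicial maps $N\Lambda_t\to N\Lambda'_t$ through $f_1$. The \emph{filtration value} of a simplex $\sigma$ of $\bigcup_{t>0}N\Lambda_t$ is $\inf\{t>0\mid\sigma\in N\Lambda_t\}$. For a finite $X\subseteq\mathbb{R}^n$ let $\mathrm{Vor}(X,x)=\{p\in\mathbb{R}^n\mid d(x,p)\le d(y,p)\ \forall y\in X\}$ and $\mathrm{Vor}(X)=\{(x,\mathrm{Vor}(X,x))\mid x\in X\}$; for finite $X_1,X_2\subseteq\mathbb{R}^n$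 let $\mathrm{Vor}(X_1,X_2)=\mathrm{Vor}(X_1)\cup\mathrm{Vor}(X_2)$, a set of pairs. Let $S$ be one of these finite sets, with the discrete topology. Call $\varepsilon>0$ \emph{admissible for $S$} if $2\varepsilon<\inf_{p\in\mathbb{R}^n}\max_{(x,V)\in\sigma}d(p,V)$ for every non-empty $\sigma\subseteq S$ with $\bigcap_{(x,V)\in\sigma}V=\emptyset$. Let $h_\varepsilon\colon[0,\infty]\to[0,\infty]$ be $h_\varepsilon(t)=-\ln(1-t/\varepsilon)$ for $t<\varepsilon$ and $h_\varepsilon(t)=\infty$ for $t\ge\varepsilon$. Given an admissible $\varepsilon$, put $\mathrm{Del}^S((x,V),p)=h_\varepsilon(d(p,V))$, a dissimilarity on $S\times\mathbb{R}^n$. Now let $X_1,X_2\subseteq\mathbb{R}^d$ be finite. For $i=1,2$ let $A^{X_i}\colon\mathrm{Vor}(X_i)\times\mathbb{R}^d\to[0,\infty]$ be the alpha dissimilarity $((x,V),p)\mapsto\max(d(x,p),\mathrm{Del}^{\mathrm{Vor}(X_i)}((x,V),p))$, formed with any $\varepsilon_i>0$ admissible for $\mathrm{Vor}(X_i)$,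 let $s_i$ be a real number larger than the filtration value of every simplex of $\bigcup_{t>0}NA^{X_i}_t$, and let $s(X_1,X_2)=\max(s_1,s_2)$. For $s>0$ let $Z=X_1\times\{s\}\cup X_2\times\{-s\}\subseteq\mathbb{R}^{d+1}$, let $\mathrm{pr}\colon\mathbb{R}^{d+1}\to\mathbb{R}^d$ omit the last coordinate, and let $g\colon\mathrm{Vor}(Z)\to\mathrm{Vor}(X_1,X_2)$ be given by $((x,s),V)\mapsto(x,\mathrm{Vor}(X_1,x))$ and $((x,-s),V)\mapsto(x,\mathrm{Vor}(X_2,x))$. Choose $\varepsilon>0$ admissible both for $\mathrm{Vor}(X_1,X_2)$ and for $\mathrm{Vor}(Z)$, and with this $\varepsilon$ define the dissimilarities \[\mathrm{Del\check C}^{X_1,X_2}\colon\mathrm{Vor}(X_1,X_2)\times(\mathbb{R}^d\times\mathbb{R}^d)\to[0,\infty],\quad((x,V),(p,q))\mapsto\max\bigl(d(x,p),\mathrm{Del}^{\mathrm{Vor}(X_1,X_2)}((x,V),q)\bigr),\] \[D\colon\mathrm{Vor}(Z)\times(\mathbb{R}^d\times\mathbb{R}^{d+1})\to[0,\infty],\quad((z,V),(p,q))\mapsto\max\bigl(d(\mathrm{pr}(z),p),\mathrm{Del}^{\mathrm{Vor}(Z)}((z,V),q)\bigr).\]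 \textbf{Proposition.} Let $X_1,X_2\subseteq\mathbb{R}^d$ be finite, and let $s>0$ and $s>s(X_1,X_2)$. Then $g$ and $\mathrm{id}\times\mathrm{pr}\colon\mathbb{R}^d\times\mathbb{R}^{d+1}\to\mathbb{R}^d\times\mathbb{R}^d$ form a morphism of dissimilarities $f=(g,\mathrm{id}\times\mathrm{pr})\colon D\to\mathrm{Del\check C}^{X_1,X_2}$, and for every real $t>0$ the induced map of geometric realizations $|g|\colon|ND_t|\to|N\mathrm{Del\check C}^{X_1,X_2}_t|$ is a homotopy equivalence. -/

import Mathlib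

open scoped ENNReal

noncomputable section

namespace RelDelaunay

/-! ### Dissimilarities, morphisms and Dowker nerves -/

/-- A dissimilarity: a continuous function `X × Y → [0, ∞]`. -/
structure Dissimilarity (X Y : Type*) [TopologicalSpace X] [TopologicalSpace Y] where
  toFun : X → Y → ℝ≥0∞
  continuous_toFun : Continuous fun a : X × Y => toFun a.1 a.2

/-- A morphism of dissimilarities: a pair of continuous maps that does not increase values. -/
structure Dissimilarity.Morphism {X Y X' Y' : Type*}
    [TopologicalSpace X] [TopologicalSpace Y] [TopologicalSpace X'] [TopologicalSpace Y']
    (Λ : Dissimilarity X Y) (Λ' : Dissimilarity X' Y') where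
  fst : X → X'
  snd : Y → Y'
  continuous_fst : Continuous fst
  continuous_snd : Continuous snd
  map_le : ∀ x y, Λ'.toFun (fst x) (snd y) ≤ Λ.toFun x y

/-- The Dowker nerve at scale `t`. As usual in Mathlib, the empty simplex is not listed among the
faces; this does not affect geometric realizations. -/
def Dissimilarity.nerve {X Y : Type*} [TopologicalSpace X] [TopologicalSpace Y]
    (Λ : Dissimilarity X Y) (t : ℝ) : PreAbstractSimplicialComplex X where
  faces := {σ | σ.Nonempty ∧ ∃ y, ∀ x ∈ σ, Λ.toFun x y < ENNReal.ofReal t}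
  isRelLowerSet_faces := by
    rintro σ ⟨hσ, y, hy⟩
    exact ⟨hσ, fun τ hτσ hτ => ⟨hτ, y, fun x hx => hy x (hτσ hx)⟩⟩

/-- The filtration value of `σ` in the filtered complex `(nerve Λ t)_{t > 0}`. -/
def Dissimilarity.filtrationValue {X Y : Type*} [TopologicalSpace X] [TopologicalSpace Y]
    (Λ : Dissimilarity X Y) (σ : Finset X) : ℝ :=
  sInf {t : ℝ | 0 < t ∧ σ ∈ Λ.nerve t}

/-- `r` is larger than the filtration value of every simplex that occurs in the filtered complex
`(nerve Λ t)_{t > 0}`. -/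
def Dissimilarity.ExceedsFiltrationValues {X Y : Type*} [TopologicalSpace X] [TopologicalSpace Y]
    (Λ : Dissimilarity X Y) (r : ℝ) : Prop :=
  ∀ σ : Finset X, (∃ t : ℝ, 0 < t ∧ σ ∈ Λ.nerve t) → Λ.filtrationValue σ < r

/-! ### Geometric realization -/

/-- The geometric realization of `K`, with the topology of a subspace of the product of copies
of `[0,1] ⊆ ℝ` indexed by the vertices. -/
def Realization {V : Type*} (K : PreAbstractSimplicialComplex V) : Set (V → ℝ) :=
  {α | (∀ v, α v ∈ Set.Icc (0 : ℝ) 1) ∧ (∃ σ ∈ K, ∀ v, v ∈ σ ↔ 0 < α v) ∧ ∑ᶠ v, α v = 1}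

open Classical in
/-- The vertex map `f` sends simplices of `K` to simplices of `L`. -/
def IsSimplicial {V W : Type*} (K : PreAbstractSimplicialComplex V)
    (L : PreAbstractSimplicialComplex W) (f : V → W) : Prop :=
  ∀ σ ∈ K, σ.image f ∈ L

/-- Push-forward of weights along a vertex map: `w ↦ ∑_{f v = w} α v`. -/
def pushforward {V W : Type*} (f : V → W) (α : V → ℝ) (w : W) : ℝ :=
  ∑ᶠ v ∈ f ⁻¹' {w}, α v

open Classical in
theorem pushforward_mem {V W : Type*} {K : PreAbstractSimplicialComplex V}
    {L : PreAbstractSimplicialComplex W} {f : V → W} (hf : IsSimplicial K L f) {α : V → ℝ}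
    (hα : α ∈ Realization K) : pushforward f α ∈ Realization L := by
  obtain ⟨h01, ⟨σ, hσ, hsupp⟩, hsum⟩ := hα
  have hzero : ∀ v, v ∉ σ → α v = 0 := fun v hv =>
    le_antisymm (not_lt.1 fun h => hv ((hsupp v).2 h)) (h01 v).1
  have hsub : Function.support α ⊆ (σ : Set V) := fun v hv => by
    by_contra h
    exact hv (hzero v h)
  have hpush : ∀ w, pushforward f α w = ∑ v ∈ σ with f v = w, α v := by
    intro w
    unfold pushforward
    rw [finsum_mem_def, finsum_eq_sum_of_support_subset (s := σ), Finset.sum_filter]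
    · refine Finset.sum_congr rfl fun v _ => ?_
      simp [Set.indicator_apply]
    · intro v hv
      apply hsub
      intro h0
      apply hv
      simp [Set.indicator_apply, h0]
  have hsum' : ∑ v ∈ σ, α v = 1 := by
    rw [← hsum, finsum_eq_sum_of_support_subset _ hsub]
  have htot : ∑ w ∈ σ.image f, pushforward f α w = 1 := by
    rw [← hsum', ← Finset.sum_fiberwise_of_maps_to (t := σ.image f) (g := f)
      (fun v hv => Finset.mem_image_of_mem f hv)]
    exact Finset.sum_congr rfl fun w _ => hpush w
  have hnn : ∀ w, 0 ≤ pushforward f α w := fun w => by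
    rw [hpush]
    exact Finset.sum_nonneg fun v _ => (h01 v).1
  have hpos : ∀ w, w ∈ σ.image f ↔ 0 < pushforward f α w := by
    intro w
    constructor
    · intro hw
      obtain ⟨v, hv, rfl⟩ := Finset.mem_image.1 hw
      rw [hpush]
      exact Finset.sum_pos' (fun u _ => (h01 u).1)
        ⟨v, Finset.mem_filter.2 ⟨hv, rfl⟩, (hsupp v).1 hv⟩
    · intro hw
      by_contra h
      rw [hpush, Finset.filter_eq_empty_iff.2, Finset.sum_empty] at hw
      · exact lt_irrefl _ hw
      · intro v hv hvw
        exact h (Finset.mem_image.2 ⟨v, hv, hvw⟩)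
  refine ⟨fun w => ⟨hnn w, ?_⟩, ⟨σ.image f, hf σ hσ, hpos⟩, ?_⟩
  · rw [hpush, ← hsum']
    exact Finset.sum_le_sum_of_subset_of_nonneg (Finset.filter_subset _ _)
      fun v _ _ => (h01 v).1
  · rw [finsum_eq_sum_of_support_subset (s := σ.image f), htot]
    intro w hw
    exact (hpos w).2 (lt_of_le_of_ne (hnn w) (Ne.symm hw))

/-- The map of geometric realizations induced by a simplicial map. -/
def realizationMap {V W : Type*} {K : PreAbstractSimplicialComplex V}
    {L : PreAbstractSimplicialComplex W} (f : V → W) (hf : IsSimplicial K L f) :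
    Realization K → Realization L :=
  fun α => ⟨pushforward f α.1, pushforward_mem hf α.2⟩

/-- The function `f` is (continuous and) a homotopy equivalence. -/
def IsHomotopyEquivalence {A B : Type*} [TopologicalSpace A] [TopologicalSpace B]
    (f : A → B) : Prop :=
  ∃ e : ContinuousMap.HomotopyEquiv A B, (e.toFun : A → B) = f

/-- A morphism of dissimilarities induces simplicial maps of Dowker nerves. -/
theorem Dissimilarity.Morphism.isSimplicial {X Y X' Y' : Type*}
    [TopologicalSpace X] [TopologicalSpace Y] [TopologicalSpace X'] [TopologicalSpace Y']
    {Λ : Dissimilarity X Y} {Λ' : Dissimilarity X' Y'} (f : Λ.Morphism Λ') (t : ℝ) :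
    IsSimplicial (Λ.nerve t) (Λ'.nerve t) f.fst := by
  classical
  rintro σ ⟨hσ, y, hy⟩
  refine ⟨by simpa using hσ, f.snd y, fun x' hx' => ?_⟩
  obtain ⟨x, hx, rfl⟩ := Finset.mem_image.1 hx'
  exact (f.map_le x y).trans_lt (hy x hx)

/-- The map `|NΛ_t| → |NΛ'_t|` induced by a morphism `Λ → Λ'`. -/
def Dissimilarity.Morphism.nerveMap {X Y X' Y' : Type*}
    [TopologicalSpace X] [TopologicalSpace Y] [TopologicalSpace X'] [TopologicalSpace Y']
    {Λ : Dissimilarity X Y} {Λ' : Dissimilarity X' Y'} (f : Λ.Morphism Λ') (t : ℝ) :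
    Realization (Λ.nerve t) → Realization (Λ'.nerve t) :=
  realizationMap f.fst (f.isSimplicial t)

/-! ### Voronoi diagrams and Delaunay complexes -/

/-- The Voronoi cell of `x` with respect to `X`. -/
def voronoiCell {E : Type*} [MetricSpace E] (X : Set E) (x : E) : Set E :=
  {p | ∀ y ∈ X, dist x p ≤ dist y p}

/-- The Voronoi diagram of `X`: the set of pairs `(x, Vor(X, x))` with `x ∈ X`. -/
def voronoi {E : Type*} [MetricSpace E] (X : Set E) : Set (E × Set E) :=
  (fun x => (x, voronoiCell X x)) '' X

/-- The Voronoi diagram of a pair: the union of the two Voronoi diagrams, as a set of pairs. -/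
def voronoiPair {E : Type*} [MetricSpace E] (X₁ X₂ : Set E) : Set (E × Set E) :=
  voronoi X₁ ∪ voronoi X₂

/-- The elements `(center, cell)` of a set `S` of pairs, as a type with the discrete topology. -/
@[ext] structure CellVertex {E : Type*} (S : Set (E × Set E)) where
  center : E
  cell : Set E
  mem : (center, cell) ∈ S

instance {E : Type*} (S : Set (E × Set E)) : TopologicalSpace (CellVertex S) := ⊥

instance {E : Type*} (S : Set (E × Set E)) : DiscreteTopology (CellVertex S) := ⟨rfl⟩

/-- The Delaunay complex: a non-empty finite set of cells is a simplex iff the cells in it have a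
common point. -/
def delaunayComplex {E : Type*} (S : Set (E × Set E)) :
    PreAbstractSimplicialComplex (CellVertex S) where
  faces := {σ | σ.Nonempty ∧ ∃ p, ∀ v ∈ σ, p ∈ v.cell}
  isRelLowerSet_faces := by
    rintro σ ⟨hσ, p, hp⟩
    exact ⟨hσ, fun τ hτσ hτ => ⟨hτ, p, fun v hv => hp v (hτσ hv)⟩⟩

/-- `ε_σ`: the infimum over `p` of the maximal distance from `p` to a cell in `σ`. -/
def separation {E : Type*} [MetricSpace E] {S : Set (E × Set E)} (σ : Finset (CellVertex S)) :
    ℝ≥0∞ :=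
  ⨅ p : E, σ.sup fun v => Metric.infEDist p v.cell

/-- The condition on the thickening parameter: `2 ε < ε_σ` for every (non-empty) finite set `σ` of
cells that is not a simplex of the Delaunay complex. -/
def IsAdmissible {E : Type*} [MetricSpace E] (S : Set (E × Set E)) (ε : ℝ) : Prop :=
  ∀ σ : Finset (CellVertex S), σ.Nonempty → σ ∉ delaunayComplex S →
    ENNReal.ofReal (2 * ε) < separation σ

/-- The map `h : [0, ∞] → [0, ∞]`, `h(t) = - ln (1 - t / ε)` for `t < ε` and `h(t) = ∞` for
`t ≥ ε`. -/
def thicken (ε : ℝ) (t : ℝ≥0∞) : ℝ≥0∞ :=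
  open Classical in
  if t < ENNReal.ofReal ε then ENNReal.ofReal (-Real.log (1 - t.toReal / ε)) else ⊤

theorem continuous_thicken {ε : ℝ} (hε : 0 < ε) : Continuous (thicken ε) := by
  have key : thicken ε = fun t => (-(ENNReal.log (1 - t / ENNReal.ofReal ε))).toENNReal := by
    funext t
    have hε0 : ENNReal.ofReal ε ≠ 0 := by simpa using hε
    unfold thicken
    split_ifs with ht
    · have htt : t ≠ ⊤ := ht.ne_top
      have hlt : t.toReal < ε := (ENNReal.lt_ofReal_iff_toReal_lt htt).1 ht
      have hd : 1 - t / ENNReal.ofReal ε = ENNReal.ofReal (1 - t.toReal / ε) := by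
        rw [ENNReal.ofReal_sub _ (by positivity), ENNReal.ofReal_div_of_pos hε,
          ENNReal.ofReal_toReal htt, ENNReal.ofReal_one]
      have hpos : 0 < 1 - t.toReal / ε := by
        rw [sub_pos, div_lt_one hε]
        exact hlt
      rw [hd, ENNReal.log_ofReal_of_pos hpos, ← EReal.coe_neg, EReal.toENNReal_of_ne_top (by simp)]
      simp
    · have h1 : 1 - t / ENNReal.ofReal ε = 0 := by
        rw [tsub_eq_zero_iff_le, ENNReal.le_div_iff_mul_le (Or.inl hε0) (Or.inl (by simp)), one_mul]
        exact not_lt.1 ht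
      simp [h1]
  rw [key]
  refine EReal.continuous_toENNReal.comp (continuous_neg.comp (ENNReal.continuous_log.comp ?_))
  exact (ENNReal.continuous_sub_left (by simp)).comp
    (ENNReal.continuous_div_const _ (by simpa using hε))

/-- The Delaunay dissimilarity `((x, V), p) ↦ h (d (p, V))`. -/
def delaunay {E : Type*} [MetricSpace E] (S : Set (E × Set E)) {ε : ℝ} (hε : 0 < ε) :
    Dissimilarity (CellVertex S) E where
  toFun v p := thicken ε (Metric.infEDist p v.cell)
  continuous_toFun := by
    refine continuous_prod_of_discrete_left.2 fun v => ?_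
    dsimp only
    exact (continuous_thicken hε).comp Metric.continuous_infEDist

/-- The alpha dissimilarity `((x, V), p) ↦ max (d (x, p)) (h (d (p, V)))`. -/
def alpha {E : Type*} [MetricSpace E] (S : Set (E × Set E)) {ε : ℝ} (hε : 0 < ε) :
    Dissimilarity (CellVertex S) E where
  toFun v p := max (edist v.center p) ((delaunay S hε).toFun v p)
  continuous_toFun := by
    refine continuous_prod_of_discrete_left.2 fun v => ?_
    dsimp only
    exact (continuous_const.edist continuous_id).max
      ((delaunay S hε).continuous_toFun.comp (Continuous.prodMk_right v))

/-- The Delaunay Čech dissimilarity `((x, V), (p, q)) ↦ max (d (x, p)) (h (d (q, V)))`. -/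
def delaunayCech {E : Type*} [MetricSpace E] (S : Set (E × Set E)) {ε : ℝ} (hε : 0 < ε) :
    Dissimilarity (CellVertex S) (E × E) where
  toFun v a := max (edist v.center a.1) ((delaunay S hε).toFun v a.2)
  continuous_toFun := by
    refine continuous_prod_of_discrete_left.2 fun v => ?_
    dsimp only
    exact (continuous_const.edist continuous_fst).max
      ((delaunay S hε).continuous_toFun.comp ((Continuous.prodMk_right v).comp continuous_snd))

/-! ### The lift to one dimension higher -/

/-- The projection `ℝ^(d+1) → ℝ^d` omitting the last coordinate. -/
def pr {d : ℕ} (q : EuclideanSpace ℝ (Fin (d + 1))) : EuclideanSpace ℝ (Fin d) :=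
  WithLp.toLp 2 fun i => q i.castSucc

theorem continuous_pr {d : ℕ} : Continuous (pr (d := d)) := by
  unfold pr
  fun_prop

/-- The point `(x, r)` of `ℝ^(d+1)`. -/
def atHeight {d : ℕ} (r : ℝ) (x : EuclideanSpace ℝ (Fin d)) : EuclideanSpace ℝ (Fin (d + 1)) :=
  WithLp.toLp 2 (Fin.snoc (α := fun _ => ℝ) (fun i => x i) r)

@[simp] theorem pr_atHeight {d : ℕ} (r : ℝ) (x : EuclideanSpace ℝ (Fin d)) :
    pr (atHeight r x) = x := by
  ext i
  simp [pr, atHeight]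

@[simp] theorem atHeight_last {d : ℕ} (r : ℝ) (x : EuclideanSpace ℝ (Fin d)) :
    atHeight r x (Fin.last d) = r := by
  simp [atHeight]

/-- `Z = X₁ × {s} ∪ X₂ × {-s}`. -/
def liftedUnion {d : ℕ} (X₁ X₂ : Set (EuclideanSpace ℝ (Fin d))) (s : ℝ) :
    Set (EuclideanSpace ℝ (Fin (d + 1))) :=
  atHeight s '' X₁ ∪ atHeight (-s) '' X₂

theorem pr_mem_of_last_eq {d : ℕ} {X₁ X₂ : Set (EuclideanSpace ℝ (Fin d))} {s : ℝ} (hs : 0 < s)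
    (v : CellVertex (voronoi (liftedUnion X₁ X₂ s))) (h : v.center (Fin.last d) = s) :
    pr v.center ∈ X₁ := by
  obtain ⟨z, hz, hzv⟩ := v.mem
  obtain rfl : z = v.center := congrArg Prod.fst hzv
  rcases hz with ⟨x, hx, hxz⟩ | ⟨x, hx, hxz⟩
  · rw [← hxz, pr_atHeight]
    exact hx
  · rw [← hxz, atHeight_last] at h
    linarith

theorem pr_mem_of_last_ne {d : ℕ} {X₁ X₂ : Set (EuclideanSpace ℝ (Fin d))} {s : ℝ}
    (v : CellVertex (voronoi (liftedUnion X₁ X₂ s))) (h : v.center (Fin.last d) ≠ s) :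
    pr v.center ∈ X₂ := by
  obtain ⟨z, hz, hzv⟩ := v.mem
  obtain rfl : z = v.center := congrArg Prod.fst hzv
  rcases hz with ⟨x, hx, hxz⟩ | ⟨x, hx, hxz⟩
  · rw [← hxz, atHeight_last] at h
    exact absurd rfl h
  · rw [← hxz, pr_atHeight]
    exact hx

open Classical in
/-- The map `g : Vor(Z) → Vor(X₁, X₂)`, which sends `((x, s), V)` to `(x, Vor(X₁, x))` and
`((x, -s), V)` to `(x, Vor(X₂, x))`. -/
def projVertex {d : ℕ} (X₁ X₂ : Set (EuclideanSpace ℝ (Fin d))) {s : ℝ} (hs : 0 < s)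
    (v : CellVertex (voronoi (liftedUnion X₁ X₂ s))) : CellVertex (voronoiPair X₁ X₂) :=
  if h : v.center (Fin.last d) = s then
    ⟨pr v.center, voronoiCell X₁ (pr v.center), Or.inl ⟨_, pr_mem_of_last_eq hs v h, rfl⟩⟩
  else
    ⟨pr v.center, voronoiCell X₂ (pr v.center), Or.inr ⟨_, pr_mem_of_last_ne v h, rfl⟩⟩

/-- The dissimilarity `D : Vor(Z) × (ℝ^d × ℝ^(d+1)) → [0, ∞]`,
`((z, V), (p, q)) ↦ max (d (pr z, p)) (h (d (q, V)))`. -/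
def liftedDelaunayCech {d : ℕ} (X₁ X₂ : Set (EuclideanSpace ℝ (Fin d))) (s : ℝ) {ε : ℝ}
    (hε : 0 < ε) :
    Dissimilarity (CellVertex (voronoi (liftedUnion X₁ X₂ s)))
      (EuclideanSpace ℝ (Fin d) × EuclideanSpace ℝ (Fin (d + 1))) where
  toFun v a := max (edist (pr v.center) a.1)
    ((delaunay (voronoi (liftedUnion X₁ X₂ s)) hε).toFun v a.2)
  continuous_toFun := by
    refine continuous_prod_of_discrete_left.2 fun v => ?_
    dsimp only
    exact (continuous_const.edist continuous_fst).max
      ((delaunay (voronoi (liftedUnion X₁ X₂ s)) hε).continuous_toFun.comp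
        ((Continuous.prodMk_right v).comp continuous_snd))

end RelDelaunay

end

open scoped ENNReal

namespace RelDelaunay

/-! ### Realizations of complexes with finitely many vertices -/

section Realization

variable {V W : Type*} {K : PreAbstractSimplicialComplex V} {L : PreAbstractSimplicialComplex W}

/-! The map `g` exhibits the nerve of `D` as the full preimage of the nerve of the Delaunay Čech
dissimilarity: for `t > 0`, `σ` is a simplex upstairs iff `g(σ)` is one downstairs
(`mem_nerve_liftedDelaunayCech_iff_image`). A surjective vertex map with this property only merges
or duplicates vertices, so a section of it is a homotopy inverse via a straight-line homotopy
(`isHomotopyEquivalence_realizationMap`). Fibres can have two elements, namely when a pair `(x, V)`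
lies in both Voronoi diagrams.

For the full preimage property, the two witness coordinates are independent, so being a simplex
splits into a Čech condition on centers, which `g` preserves, and a Delaunay condition.
Admissibility turns the latter into "the cells have a common point", independently of `t`
(`mem_nerve_delaunay_iff`). Cells of `Z` have a common point iff their images do: a common point
projects down (`pr_mem_projVertex_cell`), and a common point downstairs lifts to a height that
balances the two layers of `Z` (`exists_forall_mem_cell`). -/

open Classical in
theorem mem_realization_iff [Fintype V] {α : V → ℝ} :
    α ∈ Realization K ↔
      (∀ v, 0 ≤ α v) ∧ Finset.univ.filter (fun v => 0 < α v) ∈ K ∧ ∑ v, α v = 1 := by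
  constructor
  · rintro ⟨h01, ⟨σ, hσ, hsupp⟩, hsum⟩
    refine ⟨fun v => (h01 v).1, ?_, by rwa [finsum_eq_sum_of_fintype] at hsum⟩
    convert hσ
    ext v
    simp [hsupp]
  · rintro ⟨h0, hK, hsum⟩
    refine ⟨fun v => ⟨h0 v, ?_⟩, ⟨_, hK, by simp⟩, by rwa [finsum_eq_sum_of_fintype]⟩
    rw [← hsum]
    exact Finset.single_le_sum (fun u _ => h0 u) (Finset.mem_univ v)

open Classical in
theorem pushforward_eq_sum [Fintype V] (f : V → W) (α : V → ℝ) (w : W) :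
    pushforward f α w = ∑ v with f v = w, α v := by
  unfold pushforward
  rw [finsum_mem_def, finsum_eq_sum_of_fintype, Finset.sum_filter]
  exact Finset.sum_congr rfl fun v _ => by simp [Set.indicator_apply]

theorem pushforward_id [Fintype V] (α : V → ℝ) : pushforward id α = α := by
  classical
  funext w
  simp [pushforward_eq_sum, Finset.sum_filter]

theorem pushforward_pushforward {U : Type*} [Fintype U] [Fintype V] (r : U → V) (f : V → W)
    (α : U → ℝ) : pushforward f (pushforward r α) = pushforward (f ∘ r) α := by
  classical
  funext w
  simp only [pushforward_eq_sum]
  rw [← Finset.sum_fiberwise_of_maps_to (s := Finset.univ.filter fun u => (f ∘ r) u = w)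
    (t := Finset.univ.filter fun v => f v = w) (g := r) (fun u hu => by simpa using hu)]
  refine Finset.sum_congr rfl fun v hv => Finset.sum_congr ?_ fun _ _ => rfl
  ext u
  simp only [Finset.mem_filter, Finset.mem_univ, true_and, Function.comp_apply] at hv ⊢
  exact ⟨fun h => ⟨h ▸ hv, h⟩, fun h => h.2⟩

theorem exists_pos_of_pushforward_pos [Fintype V] {f : V → W} {α : V → ℝ} {w : W}
    (h : 0 < pushforward f α w) : ∃ v, 0 < α v ∧ f v = w := by
  classical
  rw [pushforward_eq_sum] at h
  by_contra! hneg
  exact h.not_ge (Finset.sum_nonpos fun v hv =>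
    not_lt.1 fun hpos => hneg v hpos (Finset.mem_filter.1 hv).2)

theorem continuous_pushforward [Finite V] (f : V → W) : Continuous (pushforward f) := by
  classical
  have := Fintype.ofFinite V
  refine continuous_pi fun w => ?_
  simp only [pushforward_eq_sum]
  fun_prop

theorem continuous_realizationMap [Finite V] (f : V → W) (hf : IsSimplicial K L f) :
    Continuous (realizationMap f hf) :=
  ((continuous_pushforward f).comp continuous_subtype_val).subtype_mk _

open Classical in
/-- If `K` is the full preimage of `L` under `f`, a weight whose support has its image in the
image of the support of a point of `|K|` lies in `|K|`. -/
theorem mem_realization_of_support [Fintype V] {f : V → W} (hKL : ∀ σ, σ ∈ K ↔ σ.image f ∈ L)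
    {α β : V → ℝ} (hα : α ∈ Realization K) (hβ : ∀ v, 0 ≤ β v) (hsum : ∑ v, β v = 1)
    (h : ∀ v, 0 < β v → ∃ u, 0 < α u ∧ f u = f v) : β ∈ Realization K := by
  rw [mem_realization_iff] at hα ⊢
  refine ⟨hβ, ?_, hsum⟩
  rw [hKL]
  refine (L.isRelLowerSet_faces ((hKL _).1 hα.2.1)).2 ?_ ?_
  · intro w hw
    simp only [Finset.mem_image, Finset.mem_filter, Finset.mem_univ, true_and] at hw ⊢
    obtain ⟨v, hv, rfl⟩ := hw
    exact h v hv
  · obtain ⟨v, hv⟩ : ∃ v, 0 < β v := by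
      by_contra! hneg
      linarith [Finset.sum_nonpos fun v (_ : v ∈ Finset.univ) => hneg v]
    exact ⟨f v, Finset.mem_image_of_mem f (by simpa using hv)⟩

open Classical in
/-- If `K` is the full preimage of `L` under a surjective vertex map `f`, then `|f|` is a homotopy
equivalence. -/
theorem isHomotopyEquivalence_realizationMap [Finite V] {f : V → W}
    (hsurj : Function.Surjective f) (hKL : ∀ σ, σ ∈ K ↔ σ.image f ∈ L)
    (hf : IsSimplicial K L f) : IsHomotopyEquivalence (realizationMap f hf) := by
  have := Finite.of_surjective f hsurj
  have := Fintype.ofFinite V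
  have := Fintype.ofFinite W
  obtain ⟨r, hr⟩ := hsurj.hasRightInverse
  have hfr : f ∘ r = id := funext hr
  -- A section of `f` is automatically simplicial: `f` sends `r(τ)` back to `τ`, and `K` is the full
  -- preimage of `L`.
  have hr' : IsSimplicial L K r := fun τ hτ => by
    rw [hKL, Finset.image_image]
    convert hτ
    rw [hfr, Finset.image_id]
  let F : C(Realization K, Realization L) := ⟨_, continuous_realizationMap f hf⟩
  let R : C(Realization L, Realization K) := ⟨_, continuous_realizationMap r hr'⟩
  -- The segment from `R (F α)` to `α` stays in `|K|`: every vertex charged along it has the same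
  -- image under `f` as some vertex in the support of `α`.
  have hline : ∀ (t : unitInterval) (α : Realization K),
      (fun v => (1 - (t : ℝ)) * (R (F α)).1 v + t * α.1 v) ∈ Realization K := by
    intro t α
    have h₁ := mem_realization_iff.1 (R (F α)).2
    have h₂ := mem_realization_iff.1 α.2
    have ht₀ := t.2.1
    have ht₁ : (0 : ℝ) ≤ 1 - t := sub_nonneg.2 t.2.2
    refine mem_realization_of_support hKL α.2
      (fun v => add_nonneg (mul_nonneg ht₁ (h₁.1 v)) (mul_nonneg ht₀ (h₂.1 v))) ?_ ?_
    · rw [Finset.sum_add_distrib, ← Finset.mul_sum, ← Finset.mul_sum, h₁.2.2, h₂.2.2]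
      ring
    · intro v hv
      rcases (h₂.1 v).lt_or_eq with h | h
      · exact ⟨v, h, rfl⟩
      · have hpos : 0 < (R (F α)).1 v := by
          refine (h₁.1 v).lt_of_ne fun h0 => ?_
          simp [← h, ← h0] at hv
        obtain ⟨w, hw, rfl⟩ := exists_pos_of_pushforward_pos hpos
        obtain ⟨u, hu, rfl⟩ := exists_pos_of_pushforward_pos hw
        exact ⟨u, hu, (hr _).symm⟩
  refine ⟨⟨F, R, ⟨⟨⟨fun a => ⟨_, hline a.1 a.2⟩, ?_⟩, ?_, ?_⟩⟩, ?_⟩, rfl⟩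
  · refine Continuous.subtype_mk (continuous_pi fun v => ?_) _
    have h₁ : Continuous fun a : unitInterval × Realization K => (R (F a.2)).1 v :=
      (continuous_apply v).comp (continuous_subtype_val.comp
        ((R.continuous.comp F.continuous).comp continuous_snd))
    have h₂ : Continuous fun a : unitInterval × Realization K => a.2.1 v :=
      (continuous_apply v).comp (continuous_subtype_val.comp continuous_snd)
    have h₀ : Continuous fun a : unitInterval × Realization K => (a.1 : ℝ) :=
      continuous_subtype_val.comp continuous_fst
    exact ((continuous_const.sub h₀).mul h₁).add (h₀.mul h₂)
  · intro α
    ext v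
    simp
  · intro α
    ext v
    simp
  -- On this side the composite is the identity on the nose, so a constant homotopy suffices.
  · have : F.comp R = ContinuousMap.id _ := by
      ext1 β
      apply Subtype.ext
      change pushforward f (pushforward r β.1) = β.1
      rw [pushforward_pushforward, hfr, pushforward_id]
    rw [this]

end Realization

/-! ### Nerves with an admissible thickening parameter -/

theorem thicken_mono {ε : ℝ} (hε : 0 < ε) : Monotone (thicken ε) := by
  intro a b hab
  unfold thicken
  split_ifs with ha hb hb
  · apply ENNReal.ofReal_le_ofReal
    have hb' : b.toReal < ε := (ENNReal.lt_ofReal_iff_toReal_lt hb.ne_top).1 hb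
    have h : a.toReal ≤ b.toReal := ENNReal.toReal_mono hb.ne_top hab
    have hpos : 0 < 1 - b.toReal / ε := by rwa [sub_pos, div_lt_one hε]
    have := Real.log_le_log hpos (sub_le_sub_left (div_le_div_of_nonneg_right h hε.le) 1)
    linarith
  · exact le_top
  · exact absurd (hab.trans_lt hb) ha
  · exact le_rfl

theorem thicken_zero {ε : ℝ} (hε : 0 < ε) : thicken ε 0 = 0 := by
  simp [thicken, hε]

theorem lt_of_thicken_ne_top {ε : ℝ} {a : ℝ≥0∞} (h : thicken ε a ≠ ⊤) :
    a < ENNReal.ofReal ε := by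
  by_contra h'
  exact h (if_neg h')

theorem finite_cellVertex {E : Type*} {S : Set (E × Set E)} (hS : S.Finite) : Finite (CellVertex S) := by
  have := hS.to_subtype
  refine Finite.of_injective (fun v : CellVertex S => (⟨_, v.mem⟩ : S)) fun v w h => ?_
  have h' := congrArg Subtype.val h
  exact CellVertex.ext (congrArg Prod.fst h') (congrArg Prod.snd h')

section Nerve

variable {E : Type*} [MetricSpace E] {S : Set (E × Set E)} {ε : ℝ}

/-- For an admissible thickening parameter, the nerve of the Delaunay dissimilarity is the
Delaunay complex at every positive scale. -/
theorem mem_nerve_delaunay_iff (hε : 0 < ε) (hadm : IsAdmissible S ε) {t : ℝ} (ht : 0 < t)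
    {σ : Finset (CellVertex S)} : σ ∈ (delaunay S hε).nerve t ↔ σ ∈ delaunayComplex S := by
  constructor
  · rintro ⟨hσ, q, hq⟩
    by_contra h
    -- A finite thickened value puts `q` within `ε` of every cell of `σ`, so the separation of `σ`
    -- is at most `ε ≤ 2 ε`, against admissibility.
    refine (hadm σ hσ h).not_ge ((iInf_le _ q).trans (Finset.sup_le fun v hv => ?_))
    refine (lt_of_thicken_ne_top (hq v hv).ne_top).le.trans (ENNReal.ofReal_le_ofReal ?_)
    linarith
  · rintro ⟨hσ, p, hp⟩
    refine ⟨hσ, p, fun v hv => ?_⟩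
    change thicken ε _ < _
    rw [Metric.infEDist_zero_of_mem (hp v hv), thicken_zero hε]
    simpa using ht

/-- A witness is a pair `(p, q)` whose coordinates enter different terms of the maximum, so they can
be chosen independently. -/
theorem mem_nerve_delaunayCech_iff (hε : 0 < ε) (hadm : IsAdmissible S ε) {t : ℝ} (ht : 0 < t)
    {σ : Finset (CellVertex S)} : σ ∈ (delaunayCech S hε).nerve t ↔
      (∃ p, ∀ v ∈ σ, edist v.center p < ENNReal.ofReal t) ∧ σ ∈ delaunayComplex S := by
  rw [← mem_nerve_delaunay_iff hε hadm ht]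
  constructor
  · rintro ⟨hσ, a, ha⟩
    exact ⟨⟨a.1, fun v hv => (max_lt_iff.1 (ha v hv)).1⟩,
      hσ, a.2, fun v hv => (max_lt_iff.1 (ha v hv)).2⟩
  · rintro ⟨⟨p, hp⟩, hσ, q, hq⟩
    exact ⟨hσ, (p, q), fun v hv => max_lt (hp v hv) (hq v hv)⟩

theorem CellVertex.center_mem {X : Set E} (v : CellVertex (voronoi X)) : v.center ∈ X := by
  obtain ⟨z, hz, hzv⟩ := v.mem
  obtain rfl : z = v.center := congrArg Prod.fst hzv
  exact hz

theorem CellVertex.cell_eq {X : Set E} (v : CellVertex (voronoi X)) :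
    v.cell = voronoiCell X v.center := by
  obtain ⟨z, hz, hzv⟩ := v.mem
  obtain rfl : z = v.center := congrArg Prod.fst hzv
  exact (congrArg Prod.snd hzv).symm

end Nerve

/-! ### The lifted union -/

section Lift

variable {d : ℕ} {X₁ X₂ : Set (EuclideanSpace ℝ (Fin d))} {s : ℝ}

theorem dist_sq_eq_pr (z q : EuclideanSpace ℝ (Fin (d + 1))) :
    dist z q ^ 2 = dist (pr z) (pr q) ^ 2 + (z (Fin.last d) - q (Fin.last d)) ^ 2 := by
  simp [EuclideanSpace.dist_sq_eq, Fin.sum_univ_castSucc, pr, Real.dist_eq]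

theorem edist_pr_le (z q : EuclideanSpace ℝ (Fin (d + 1))) :
    edist (pr z) (pr q) ≤ edist z q := by
  rw [edist_dist, edist_dist]
  refine ENNReal.ofReal_le_ofReal (abs_le_of_sq_le_sq' ?_ dist_nonneg).2
  rw [dist_sq_eq_pr z q]
  nlinarith [sq_nonneg (z (Fin.last d) - q (Fin.last d))]

/-- Pythagoras separates horizontal and vertical distance, with one family of inequalities per layer
of `Z`. -/
theorem mem_voronoiCell_liftedUnion_iff (z q : EuclideanSpace ℝ (Fin (d + 1))) :
    q ∈ voronoiCell (liftedUnion X₁ X₂ s) z ↔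
      (∀ y ∈ X₁, dist z q ^ 2 ≤ dist y (pr q) ^ 2 + (s - q (Fin.last d)) ^ 2) ∧
      ∀ y ∈ X₂, dist z q ^ 2 ≤ dist y (pr q) ^ 2 + (-s - q (Fin.last d)) ^ 2 := by
  have key : ∀ (r : ℝ) (y : EuclideanSpace ℝ (Fin d)), dist z q ≤ dist (atHeight r y) q ↔
      dist z q ^ 2 ≤ dist y (pr q) ^ 2 + (r - q (Fin.last d)) ^ 2 := fun r y => by
    rw [← sq_le_sq₀ dist_nonneg dist_nonneg, dist_sq_eq_pr (atHeight r y), pr_atHeight,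
      atHeight_last]
  simp only [voronoiCell, liftedUnion, Set.mem_ofPred_eq, Set.mem_union, or_imp, forall_and,
    Set.forall_mem_image, key]

theorem last_eq_or (v : CellVertex (voronoi (liftedUnion X₁ X₂ s))) :
    v.center (Fin.last d) = s ∨ v.center (Fin.last d) = -s := by
  rcases v.center_mem with ⟨x, -, hx⟩ | ⟨x, -, hx⟩
  · exact Or.inl (by rw [← hx, atHeight_last])
  · exact Or.inr (by rw [← hx, atHeight_last])

theorem projVertex_center (hs : 0 < s) (v : CellVertex (voronoi (liftedUnion X₁ X₂ s))) :
    (projVertex X₁ X₂ hs v).center = pr v.center := by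
  unfold projVertex
  split_ifs <;> rfl

theorem projVertex_of_last_eq (hs : 0 < s) (v : CellVertex (voronoi (liftedUnion X₁ X₂ s)))
    (h : v.center (Fin.last d) = s) :
    (projVertex X₁ X₂ hs v).cell = voronoiCell X₁ (pr v.center) := by
  unfold projVertex
  rw [dif_pos h]

theorem projVertex_of_last_eq_neg (hs : 0 < s)
    (v : CellVertex (voronoi (liftedUnion X₁ X₂ s))) (h : v.center (Fin.last d) = -s) :
    (projVertex X₁ X₂ hs v).cell = voronoiCell X₂ (pr v.center) := by
  unfold projVertex
  rw [dif_neg (by linarith)]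

theorem surjective_projVertex (hs : 0 < s) : Function.Surjective (projVertex X₁ X₂ hs) := by
  rintro ⟨x, V, ⟨y, hy, h⟩ | ⟨y, hy, h⟩⟩ <;> obtain ⟨rfl, rfl⟩ := Prod.mk.inj h
  · refine ⟨⟨atHeight s y, _, _, Or.inl ⟨y, hy, rfl⟩, rfl⟩, ?_⟩
    ext1
    · simp [projVertex_center]
    · rw [projVertex_of_last_eq hs _ (by simp)]
      simp
  · refine ⟨⟨atHeight (-s) y, _, _, Or.inr ⟨y, hy, rfl⟩, rfl⟩, ?_⟩
    ext1
    · simp [projVertex_center]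
    · rw [projVertex_of_last_eq_neg hs _ (by simp)]
      simp

/-- Only competitors in the layer of `v` matter; against these the vertical terms cancel. -/
theorem pr_mem_projVertex_cell (hs : 0 < s) (v : CellVertex (voronoi (liftedUnion X₁ X₂ s)))
    {q : EuclideanSpace ℝ (Fin (d + 1))} (hq : q ∈ v.cell) :
    pr q ∈ (projVertex X₁ X₂ hs v).cell := by
  rw [v.cell_eq, mem_voronoiCell_liftedUnion_iff, dist_sq_eq_pr] at hq
  rcases last_eq_or v with h | h
  · rw [projVertex_of_last_eq hs v h]
    intro y hy
    have := hq.1 y hy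
    rw [h] at this
    exact (abs_le_of_sq_le_sq' (by linarith) dist_nonneg).2
  · rw [projVertex_of_last_eq_neg hs v h]
    intro y hy
    have := hq.2 y hy
    rw [h] at this
    exact (abs_le_of_sq_le_sq' (by linarith) dist_nonneg).2

/-- A common point of projected cells lifts, at a suitable height, to a common point of the
Voronoi cells of the lifted union. -/
theorem exists_forall_mem_cell (hs : 0 < s)
    {σ : Finset (CellVertex (voronoi (liftedUnion X₁ X₂ s)))} {p : EuclideanSpace ℝ (Fin d)}
    (hp : ∀ v ∈ σ, p ∈ (projVertex X₁ X₂ hs v).cell) : ∃ q, ∀ v ∈ σ, q ∈ v.cell := by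
  have hp₁ : ∀ v ∈ σ, v.center (Fin.last d) = s → ∀ y ∈ X₁,
      dist (pr v.center) p ^ 2 ≤ dist y p ^ 2 := fun v hv h y hy => by
    have := hp v hv
    rw [projVertex_of_last_eq hs v h] at this
    exact pow_le_pow_left₀ dist_nonneg (this y hy) 2
  have hp₂ : ∀ v ∈ σ, v.center (Fin.last d) = -s → ∀ y ∈ X₂,
      dist (pr v.center) p ^ 2 ≤ dist y p ^ 2 := fun v hv h y hy => by
    have := hp v hv
    rw [projVertex_of_last_eq_neg hs v h] at this
    exact pow_le_pow_left₀ dist_nonneg (this y hy) 2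
  have hX₁ : ∀ v : CellVertex (voronoi (liftedUnion X₁ X₂ s)),
      v.center (Fin.last d) = s → pr v.center ∈ X₁ := fun v h => pr_mem_of_last_eq hs v h
  have hX₂ : ∀ v : CellVertex (voronoi (liftedUnion X₁ X₂ s)),
      v.center (Fin.last d) = -s → pr v.center ∈ X₂ := fun v h =>
    pr_mem_of_last_ne v (by linarith)
  -- At height `h` the squared vertical distances to the layers `-s` and `s` differ by `(s + h)² -
  -- (s - h)² = 4 s h`. The two conditions are therefore the comparisons of centers of `σ` with the
  -- opposite layer; comparisons within a layer hold at any height.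
  obtain ⟨h, hh₁, hh₂⟩ : ∃ h : ℝ,
      (∀ v ∈ σ, v.center (Fin.last d) = s → ∀ y ∈ X₂,
        dist (pr v.center) p ^ 2 - 4 * s * h ≤ dist y p ^ 2) ∧
      (∀ v ∈ σ, v.center (Fin.last d) = -s → ∀ y ∈ X₁,
        dist (pr v.center) p ^ 2 + 4 * s * h ≤ dist y p ^ 2) := by
    by_cases h₁ : ∃ v ∈ σ, v.center (Fin.last d) = s
    · obtain ⟨u, hu, hus⟩ := h₁
      by_cases h₂ : ∃ v ∈ σ, v.center (Fin.last d) = -s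
      · obtain ⟨w, hw, hws⟩ := h₂
        -- This height makes the lifted point equidistant from its nearest points in the two layers.
        refine ⟨(dist (pr u.center) p ^ 2 - dist (pr w.center) p ^ 2) / (4 * s), ?_, ?_⟩ <;>
          rw [mul_div_cancel₀ _ (by positivity)] <;> intro v hv hvs y hy
        · linarith [hp₁ v hv hvs _ (hX₁ u hus), hp₂ w hw hws y hy]
        · linarith [hp₂ v hv hvs _ (hX₂ w hws), hp₁ u hu hus y hy]
      · push Not at h₂
        -- With only the upper layer in `σ`, it is enough to go so high that the left-hand side is
        -- at most `0`; this also covers an empty `X₂`. The lower layer is symmetric.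
        refine ⟨dist (pr u.center) p ^ 2 / (4 * s), ?_, fun v hv hvs => absurd hvs (h₂ v hv)⟩
        rw [mul_div_cancel₀ _ (by positivity)]
        intro v hv hvs y hy
        linarith [hp₁ v hv hvs _ (hX₁ u hus), sq_nonneg (dist y p)]
    · push Not at h₁
      by_cases h₂ : ∃ v ∈ σ, v.center (Fin.last d) = -s
      · obtain ⟨w, hw, hws⟩ := h₂
        refine ⟨-dist (pr w.center) p ^ 2 / (4 * s), fun v hv hvs => absurd hvs (h₁ v hv), ?_⟩
        rw [mul_div_cancel₀ _ (by positivity)]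
        intro v hv hvs y hy
        linarith [hp₂ v hv hvs _ (hX₂ w hws), sq_nonneg (dist y p)]
      · push Not at h₂
        exact ⟨0, fun v hv hvs => absurd hvs (h₁ v hv), fun v hv hvs => absurd hvs (h₂ v hv)⟩
  refine ⟨atHeight h p, fun v hv => ?_⟩
  rw [v.cell_eq, mem_voronoiCell_liftedUnion_iff, dist_sq_eq_pr, pr_atHeight, atHeight_last]
  rcases last_eq_or v with hvs | hvs <;> rw [hvs]
  · exact ⟨fun y hy => by linarith [hp₁ v hv hvs y hy],
      fun y hy => by linarith [hh₁ v hv hvs y hy]⟩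
  · exact ⟨fun y hy => by linarith [hh₂ v hv hvs y hy],
      fun y hy => by linarith [hp₂ v hv hvs y hy]⟩

open Classical in
theorem mem_delaunayComplex_liftedUnion_iff (hs : 0 < s)
    {σ : Finset (CellVertex (voronoi (liftedUnion X₁ X₂ s)))} :
    σ ∈ delaunayComplex (voronoi (liftedUnion X₁ X₂ s)) ↔
      σ.image (projVertex X₁ X₂ hs) ∈ delaunayComplex (voronoiPair X₁ X₂) := by
  constructor
  · rintro ⟨hσ, q, hq⟩
    exact ⟨hσ.image _, pr q,
      Finset.forall_mem_image.2 fun v hv => pr_mem_projVertex_cell hs v (hq v hv)⟩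
  · rintro ⟨hσ, p, hp⟩
    exact ⟨Finset.image_nonempty.1 hσ, exists_forall_mem_cell hs (Finset.forall_mem_image.1 hp)⟩

theorem mem_nerve_liftedDelaunayCech_iff {ε : ℝ} (hε : 0 < ε)
    (hadm : IsAdmissible (voronoi (liftedUnion X₁ X₂ s)) ε) {t : ℝ} (ht : 0 < t)
    {σ : Finset (CellVertex (voronoi (liftedUnion X₁ X₂ s)))} :
    σ ∈ (liftedDelaunayCech X₁ X₂ s hε).nerve t ↔
      (∃ p, ∀ v ∈ σ, edist (pr v.center) p < ENNReal.ofReal t) ∧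
        σ ∈ delaunayComplex (voronoi (liftedUnion X₁ X₂ s)) := by
  rw [← mem_nerve_delaunay_iff hε hadm ht]
  constructor
  · rintro ⟨hσ, a, ha⟩
    exact ⟨⟨a.1, fun v hv => (max_lt_iff.1 (ha v hv)).1⟩,
      hσ, a.2, fun v hv => (max_lt_iff.1 (ha v hv)).2⟩
  · rintro ⟨⟨p, hp⟩, hσ, q, hq⟩
    exact ⟨hσ, (p, q), fun v hv => max_lt (hp v hv) (hq v hv)⟩

open Classical in
/-- The nerve of the lifted dissimilarity is the full preimage of the nerve of the Delaunay Čech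
dissimilarity. -/
theorem mem_nerve_liftedDelaunayCech_iff_image (hs : 0 < s) {ε : ℝ} (hε : 0 < ε)
    (hadm : IsAdmissible (voronoiPair X₁ X₂) ε)
    (hadmZ : IsAdmissible (voronoi (liftedUnion X₁ X₂ s)) ε) {t : ℝ} (ht : 0 < t)
    (σ : Finset (CellVertex (voronoi (liftedUnion X₁ X₂ s)))) :
    σ ∈ (liftedDelaunayCech X₁ X₂ s hε).nerve t ↔
      σ.image (projVertex X₁ X₂ hs) ∈ (delaunayCech (voronoiPair X₁ X₂) hε).nerve t := by
  rw [mem_nerve_liftedDelaunayCech_iff hε hadmZ ht, mem_nerve_delaunayCech_iff hε hadm ht,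
    mem_delaunayComplex_liftedUnion_iff hs]
  simp only [Finset.forall_mem_image, projVertex_center]

/-- The morphism given by `projVertex` and `id × pr`. -/
noncomputable def projMorphism (X₁ X₂ : Set (EuclideanSpace ℝ (Fin d))) (hs : 0 < s) {ε : ℝ} (hε : 0 < ε) :
    (liftedDelaunayCech X₁ X₂ s hε).Morphism (delaunayCech (voronoiPair X₁ X₂) hε) where
  fst := projVertex X₁ X₂ hs
  snd := Prod.map id pr
  continuous_fst := continuous_of_discreteTopology
  continuous_snd := continuous_id.prodMap continuous_pr
  map_le v a := by
    refine max_le_max ?_ (thicken_mono hε ?_)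
    · rw [projVertex_center]
      exact le_rfl
    -- The projection is 1-Lipschitz and carries each cell into its image cell, so distances to
    -- cells do not grow.
    · refine Metric.le_infEDist.2 fun q hq => ?_
      exact (Metric.infEDist_le_edist_of_mem (pr_mem_projVertex_cell hs v hq)).trans
        (edist_pr_le _ _)

end Lift

end RelDelaunay

theorem mainTheorem3 {d : ℕ} (X₁ X₂ : Set (EuclideanSpace ℝ (Fin d)))
    (hX₁ : X₁.Finite) (hX₂ : X₂.Finite)
    -- the alpha dissimilarities of `X₁` and `X₂`, each with an admissible thickening parameter
    {ε₁ ε₂ : ℝ} (hε₁ : 0 < ε₁) (hε₂ : 0 < ε₂)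
    (hadm₁ : RelDelaunay.IsAdmissible (RelDelaunay.voronoi X₁) ε₁)
    (hadm₂ : RelDelaunay.IsAdmissible (RelDelaunay.voronoi X₂) ε₂)
    -- `s(X₁, X₂) = max s₁ s₂`
    (s₁ s₂ : ℝ)
    (hs₁ : (RelDelaunay.alpha (RelDelaunay.voronoi X₁) hε₁).ExceedsFiltrationValues s₁)
    (hs₂ : (RelDelaunay.alpha (RelDelaunay.voronoi X₂) hε₂).ExceedsFiltrationValues s₂)
    {s : ℝ} (hs : 0 < s) (hs_gt : max s₁ s₂ < s)
    {ε : ℝ} (hε : 0 < ε)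
    (hadm : RelDelaunay.IsAdmissible (RelDelaunay.voronoiPair X₁ X₂) ε)
    (hadmZ : RelDelaunay.IsAdmissible
      (RelDelaunay.voronoi (RelDelaunay.liftedUnion X₁ X₂ s)) ε) :
    ∃ f : (RelDelaunay.liftedDelaunayCech X₁ X₂ s hε).Morphism
        (RelDelaunay.delaunayCech (RelDelaunay.voronoiPair X₁ X₂) hε),
      f.fst = RelDelaunay.projVertex X₁ X₂ hs ∧
      f.snd = Prod.map id RelDelaunay.pr ∧
      ∀ t : ℝ, 0 < t → RelDelaunay.IsHomotopyEquivalence (f.nerveMap t) := by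
  have hfin : Finite (RelDelaunay.CellVertex
      (RelDelaunay.voronoi (RelDelaunay.liftedUnion X₁ X₂ s))) :=
    RelDelaunay.finite_cellVertex (((hX₁.image _).union (hX₂.image _)).image _)
  exact ⟨RelDelaunay.projMorphism X₁ X₂ hs hε, rfl, rfl, fun t ht =>
    RelDelaunay.isHomotopyEquivalence_realizationMap (RelDelaunay.surjective_projVertex hs)
      (RelDelaunay.mem_nerve_liftedDelaunayCech_iff_image hs hε hadm hadmZ ht) _⟩
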